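/- Let $G=(V,E)$ be a finite directed graph (parallel edges allowed) with $n=|V|$ vertices and capacities $c\in\mathbb N^E$, whose total capacity is polynomially bounded: $\sum_{e\in E}c(e)\le n^{a}$ for a fixed $a\in\mathbb N$ (for a simple graph with $c(e)\le n^2$ for all $e$ one may take $a=4$). **Expander hierarchies.** For $F\subseteq E$ let $\deg_F(v)$ be the total capacity of the edges of $F$ leaving or entering $v$, and $\mathrm{vol}_F(S)=\sum_{v\in S}\deg_F(v)$. $F$ is *$\phi$-expanding* in a subgraph $H$ of $G$ on the vertex set $V$ if for every strongly connected component $C$ of $H$ and every $\emptyset\ne S\subsetneq C$, $$\min\{c(E_H(S,C\setminus S)),\,c(E_H(C\setminus S,S))\}\ \ge\ \phi\cdot\min\{\mathrm{vol}_F(S),\mathrm{vol}_F(C\setminus S)\}.$$ A partition $\mathcal H=(D,X_1,\dots,X_\eta)$ of $E$ (parts may be empty) is a *$\phi$-expander hierarchy* of height $\eta$ if $D$ is acyclic and, for every $1\le i\le\eta$, with $G_i=G\setminus(X_{i+1}\cup\dots\cup X_\eta)$, each edge of $X_i$ lies inside a strongly connected component of $G_i$, and $X_i$ is $\phi$-expanding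 in $G_i$. A topological order of $D$, that is, a bijection $\tau$ from $V$ to $n$ consecutive integers with $\tau_u<\tau_v$ for every $(u,v)\in D$, is *$\mathcal H$-respecting* if $\tau(C)$ is a set of consecutive integers for every $i\in\{1,\dots,\eta\}$ and every strongly connected component $C$ of $G_i$. The induced weight of an edge is $w_{\mathcal H}(u,v)=|\tau_v-\tau_u|$. **Flows.** Let $\Delta,\nabla\in\mathbb R_{\ge0}^V$ be source and sink vectors. For $f\in\mathbb Q_{\ge0}^E$ let $f^{\mathrm{out}}(v)$ be the net flow out of $v$, $\mathrm{abs}_f(v)=\min\{\Delta(v)-f^{\mathrm{out}}(v),\nabla(v)\}$, $\mathrm{ex}_f(v)=\Delta(v)-f^{\mathrm{out}}(v)-\mathrm{abs}_f(v)$, $|f|=\sum_v\mathrm{abs}_f(v)$ and $w_{\mathcal H}(f)=\sum_e w_{\mathcal H}(e)f(e)$. Call $f$ a *$(\Delta,\nabla)$-flow* if $\mathrm{abs}_f\ge0$ and $0\le\mathrm{ex}_f\le\Delta$; it has congestion at most $\kappa$ if $f\le\kappa c$, is *feasible* if $f\le c$, and is *integral* if $f\in\mathbb N^E$. Two flows are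 *equivalent* if they have the same $f^{\mathrm{out}}$. **Theorem.** For every $a\in\mathbb N$ there is a constant $K>0$, depending only on $a$, such that for every $(G,c)$ as above, all $0<\phi\le1$ and $\eta\ge1$, every $\phi$-expander hierarchy $\mathcal H$ of $(G,c)$ of height $\eta$, every $\mathcal H$-respecting topological order $\tau$, and all $\Delta,\nabla$: 1. For every feasible integral $(\Delta,\nabla)$-flow $f$ there is a feasible (not necessarily integral) $(\Delta,\nabla)$-flow $f'$ with $$|f'|\ge\frac{|f|}{\eta+1}\qquad\text{and}\qquad w_{\mathcal H}(f')\le|f'|\cdot K\,\frac{n\,\eta^2\log n}{\phi}.$$ 2. For every $\kappa\in\mathbb N$ and every integral $(\Delta,\nabla)$-flow $f$ of congestion at most $\kappa$ there is a $(\Delta,\nabla)$-flow $f'$ equivalent to $f$, of congestion at most $(\eta+1)\kappa$, with $$w_{\mathcal H}(f')\le|f'|\cdot K\,\frac{n\,\eta^2\log n}{\phi}.$$ -/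

import Mathlib

universe u v

noncomputable section

/-- A directed multigraph with vertex set `V`, edge set `E` and natural edge capacities. -/
structure CapDigraph (V : Type u) (E : Type v) where
  src : E → V
  tgt : E → V
  cap : E → ℕ

namespace CapDigraph

variable {V : Type u} {E : Type v} [Fintype V] [Fintype E] (G : CapDigraph V E)

/-! ### Subgraphs `(V, H)` for `H ⊆ E`, strongly connected components, cuts -/

/-- There is an edge of `H` from `x` to `y`. -/
def Adj (H : Set E) (x y : V) : Prop := ∃ e ∈ H, G.src e = x ∧ G.tgt e = y

/-- `(V, H)` has no directed cycle. -/
def IsAcyclic (H : Set E) : Prop := ∀ x, ¬ Relation.TransGen (G.Adj H) x x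

/-- There is a directed path from `x` to `y` in `(V, H)`. -/
def Reach (H : Set E) (x y : V) : Prop := Relation.ReflTransGen (G.Adj H) x y

/-- `C` is (the vertex set of) a strongly connected component of `(V, H)`. -/
def IsSCC (H : Set E) (C : Set V) : Prop := ∃ x, C = {y | G.Reach H x y ∧ G.Reach H y x}

open Classical in
/-- Total capacity of the edges of `H` that go from `S` to `T`. -/
def cutCap (H : Set E) (S T : Set V) : ℕ :=
  ∑ e, if e ∈ H ∧ G.src e ∈ S ∧ G.tgt e ∈ T then G.cap e else 0

/-- `deg_{F,c}(x)`: total capacity of the edges of `F` leaving or entering `x`. -/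
def deg (F : Set E) (x : V) : ℕ := G.cutCap F {x} {x}ᶜ + G.cutCap F {x}ᶜ {x}

open Classical in
/-- `vol_{F,c}(S)`. -/
def vol (F : Set E) (S : Set V) : ℕ := ∑ x, if x ∈ S then G.deg F x else 0

/-- The cut `(S, C \ S)` of the subgraph of `(V, H)` induced on `C` is `φ`-sparse
with respect to `deg_{F,c}`. -/
def IsSparseCut (φ : ℝ) (H F : Set E) (C S : Set V) : Prop :=
  min (G.cutCap H S (C \ S) : ℝ) (G.cutCap H (C \ S) S : ℝ)
    < φ * min (G.vol F S : ℝ) (G.vol F (C \ S) : ℝ)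

/-- The edge set `F` is `φ`-expanding in `(V, H)`: no strongly connected component of `(V, H)`
has a `φ`-sparse cut with respect to `deg_{F,c}`. -/
def IsExpanding (φ : ℝ) (H F : Set E) : Prop :=
  ∀ C, G.IsSCC H C → ∀ S ⊆ C, S.Nonempty → S ≠ C → ¬ G.IsSparseCut φ H F C S

/-! ### Expander hierarchies

The ordered partition `(D, X_1, …, X_η)` of the edge set is given by the map
`lev : E → {0, …, η}` with `D = lev⁻¹(0)` and `X_i = lev⁻¹(i)` for `1 ≤ i ≤ η`. -/

/-- `D` for `i = 0`, and `X_i` for `1 ≤ i ≤ η`. -/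
def levelSet {η : ℕ} (lev : E → Fin (η + 1)) (i : Fin (η + 1)) : Set E := {e | lev e = i}

/-- The edge set of `G_i = G \ X_{>i}`. -/
def upToLevel {η : ℕ} (lev : E → Fin (η + 1)) (i : Fin (η + 1)) : Set E := {e | lev e ≤ i}

/-- `(D, X_1, …, X_η)` is a `φ`-expander hierarchy of `G`, of height `η`. -/
structure IsExpanderHierarchy (φ : ℝ) {η : ℕ} (lev : E → Fin (η + 1)) : Prop where
  acyclic : G.IsAcyclic (levelSet lev 0)
  contained : ∀ i, i ≠ 0 → ∀ e ∈ levelSet lev i,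
    ∃ C, G.IsSCC (upToLevel lev i) C ∧ G.src e ∈ C ∧ G.tgt e ∈ C
  expanding : ∀ i, i ≠ 0 → G.IsExpanding φ (upToLevel lev i) (levelSet lev i)

/-- `τ` is a topological order of `D` such that, for each level `i ≥ 1`, every strongly connected
component of `G_i` occupies a contiguous set of positions. -/
structure IsRespecting {η : ℕ} (lev : E → Fin (η + 1)) (τ : V ≃ Fin (Fintype.card V)) :
    Prop where
  topological : ∀ e ∈ levelSet lev 0, τ (G.src e) < τ (G.tgt e)
  contiguous : ∀ i, i ≠ 0 → ∀ C, G.IsSCC (upToLevel lev i) C → (τ '' C).OrdConnected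

/-- The induced weight `|τ_y - τ_x|` of an edge `e = (x, y)`. -/
def weight (τ : V ≃ Fin (Fintype.card V)) (e : E) : ℝ :=
  |((τ (G.tgt e) : ℕ) : ℝ) - ((τ (G.src e) : ℕ) : ℝ)|

/-! ### Flows (rational vectors on the edges) -/

open Classical in
/-- Net flow of `f` out of `x`. -/
def netOut (f : E → ℚ) (x : V) : ℝ :=
  (∑ e, if G.src e = x then (f e : ℝ) else 0) - ∑ e, if G.tgt e = x then (f e : ℝ) else 0

/-- The absorption of `f` for the source vector `Δ` and the sink vector `T`. -/
def absorption (Δ T : V → ℝ) (f : E → ℚ) (x : V) : ℝ := min (Δ x - G.netOut f x) (T x)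

/-- The excess of `f` for the source vector `Δ` and the sink vector `T`. -/
def excess (Δ T : V → ℝ) (f : E → ℚ) (x : V) : ℝ :=
  Δ x - G.netOut f x - G.absorption Δ T f x

/-- The value `|f|`: the total absorption. -/
def value (Δ T : V → ℝ) (f : E → ℚ) : ℝ := ∑ x, G.absorption Δ T f x

/-- `f` is a `(Δ, T)`-flow. Nonnegative absorption says that no vertex sends out, on balance, more
than its supply; `excess ≤ Δ` says that no vertex receives, on balance, more than it can absorb. -/
def IsFlow (Δ T : V → ℝ) (f : E → ℚ) : Prop :=
  (∀ e, 0 ≤ f e) ∧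
    ∀ x, 0 ≤ G.absorption Δ T f x ∧ 0 ≤ G.excess Δ T f x ∧ G.excess Δ T f x ≤ Δ x

/-- The congestion of `f` is at most `κ`. -/
def CongestionLE (f : E → ℚ) (κ : ℚ) : Prop := ∀ e, f e ≤ κ * G.cap e

/-- `f` respects the capacities. -/
def IsFeasible (f : E → ℚ) : Prop := ∀ e, f e ≤ G.cap e

/-- `f` takes values in the natural numbers. -/
def IsIntegral (f : E → ℚ) : Prop := ∀ e, ∃ k : ℕ, f e = k

/-- `f` and `g` route the same demand. -/
def Equivalent (f g : E → ℚ) : Prop := ∀ x, G.netOut f x = G.netOut g x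

/-- The weight `w(f) = ∑ e, w(e) f(e)` of `f` for the weights induced by `τ`. -/
def flowWeight (τ : V ≃ Fin (Fintype.card V)) (f : E → ℚ) : ℝ :=
  ∑ e, G.weight τ e * (f e : ℝ)

end CapDigraph

end

/-!
The flow is rerouted level by level, from the top of the hierarchy down. The step for level `i`
replaces the current integral flow by a cheapest integral flow with the same net outflows, where
each edge of `G_i` gets additional capacity `κ` times its own and where an edge of `X_i` inside the
component `C` of `G_i` costs `|C|`, all other edges being free (`exists_level_step`). The
congestion grows by `κ` in each of the `η` steps, and no step increases the flow on edges of higher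
levels, so what has been achieved there persists (`exists_flow_short_above`).

A cheapest flow comes with a vertex potential `π` that satisfies complementary slackness
(`exists_optimal_flow`); an edge with flow leads upwards in `π` by at least its cost, and an edge
with spare capacity by at most its cost. Let `P` be the value of the flow. Across each level of `π`
all flow goes upwards, so it amounts to at most `P`. Hence, in the cut of `C` at a level of `π`, the
saturated edges have total capacity at most `P / κ`, while all other edges are in `X_i` and have
both ends within `|C|` of the level. As `X_i` is expanding, the `X_i`-volume of the level sets grows
by the factor `1 + φ / 2` with each step of length `|C|`, from both ends, once it exceeds
`2 * P / (φ * κ)`. So all of `C` but a part of that volume lies in a window of `π` of length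
`O(|C| * log n / φ)`. The flow on `X_i` outside the window is bounded by the congestion, and the
flow inside pays for its cost by climbing in `π`; together `O(P * (η + log n) / φ)` units of flow on
`X_i` inside `C` (`component_bound`).

An edge of `X_i` inside `C` weighs at most `|C|`, because `C` is contiguous in `τ`. Summing over the
components and the levels bounds the weight on all edges outside `D`; those of `D` go forward in
`τ`, so their weight exceeds the net displacement of the flow along `τ`, at most `n * P`, by at most
the weight of the other edges (`exists_short_flow`). Dividing the resulting flow by `η + 1` makes
it feasible when `κ = 1` (`IsFlow.smul`).

Net outflows are compared through their pairings with vertex potentials (`CapDigraph.gain`).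
-/

noncomputable section

/-! ### Potentials from the absence of negative cycles -/

/-- `IsWalk s t r x l y`: the list `l` of arcs, each satisfying `r`, is a walk from `x` to `y`,
where the arc `a` goes from `s a` to `t a`. -/
def IsWalk {A : Type*} {V : Type*} (s t : A → V) (r : A → Prop) : V → List A → V → Prop
  | x, [], y => x = y
  | x, a :: l, y => r a ∧ s a = x ∧ IsWalk s t r (t a) l y

section Walk

variable {A : Type*} {V : Type*} {s t : A → V} {r : A → Prop}

theorem isWalk_append {x z : V} {l₁ l₂ : List A} :
    IsWalk s t r x (l₁ ++ l₂) z ↔ ∃ y, IsWalk s t r x l₁ y ∧ IsWalk s t r y l₂ z := by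
  induction l₁ generalizing x with
  | nil => simp [IsWalk]
  | cons a l ih => simp [IsWalk, ih, and_assoc]

theorem IsWalk.forall_mem {x y : V} {l : List A} (h : IsWalk s t r x l y) : ∀ a ∈ l, r a := by
  induction l generalizing x with
  | nil => simp
  | cons b l ih =>
    intro a ha
    rcases List.mem_cons.1 ha with rfl | ha
    · exact h.1
    · exact ih h.2.2 a ha

theorem IsWalk.sum_sub {x y : V} {l : List A} (h : IsWalk s t r x l y) (q : V → ℤ) :
    (l.map fun a => q (t a) - q (s a)).sum = q y - q x := by
  induction l generalizing x with
  | nil => cases h; simp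
  | cons b l ih =>
    obtain ⟨-, rfl, h⟩ := h
    simp [ih h]

theorem exists_append_of_not_nodup_map {l : List A} (h : ¬ (l.map s).Nodup) :
    ∃ l₁ a l₂ b l₃, l = l₁ ++ (a :: l₂ ++ b :: l₃) ∧ s a = s b := by
  induction l with
  | nil => simp at h
  | cons a l ih =>
    rw [List.map_cons, List.nodup_cons, not_and_or, not_not] at h
    rcases h with h | h
    · obtain ⟨b, hb, hab⟩ := List.mem_map.1 h
      obtain ⟨l₂, l₃, rfl⟩ := List.append_of_mem hb
      exact ⟨[], a, l₂, b, l₃, by simp, hab.symm⟩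
    · obtain ⟨l₁, a', l₂, b, l₃, rfl, hab⟩ := ih h
      exact ⟨a :: l₁, a', l₂, b, l₃, by simp, hab⟩

/-- If no closed walk without repeated vertices is negative, then the cost of walks is bounded
below: closed subwalks are cut out until no vertex is repeated. -/
theorem IsWalk.cost_bound [Fintype V] {k : A → ℤ} {M : ℤ} (hM : 0 ≤ M) (hk : ∀ a, r a → -M ≤ k a)
    (hs : ∀ x l, IsWalk s t r x l x → (l.map s).Nodup → 0 ≤ (l.map k).sum)
    {x y : V} {l : List A} (h : IsWalk s t r x l y) :
    -(Fintype.card V * M) ≤ (l.map k).sum ∧ (x = y → 0 ≤ (l.map k).sum) := by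
  induction hn : l.length using Nat.strong_induction_on generalizing x y l with
  | _ n ih =>
  by_cases hd : (l.map s).Nodup
  · refine ⟨?_, ?_⟩
    · have h1 : (l.map k).length • (-M) ≤ (l.map k).sum := by
        apply List.card_nsmul_le_sum
        intro z hz
        obtain ⟨a, ha, rfl⟩ := List.mem_map.1 hz
        exact hk a (h.forall_mem a ha)
      have h2 := hd.length_le_card
      rw [List.length_map] at h1 h2
      have h3 : (l.length : ℤ) * M ≤ Fintype.card V * M := by gcongr
      simp only [nsmul_eq_mul] at h1
      linarith
    · rintro rfl
      exact hs x l h hd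
  · obtain ⟨l₁, a, l₂, b, l₃, rfl, hab⟩ := exists_append_of_not_nodup_map hd
    obtain ⟨y₁, h1, h2⟩ := isWalk_append.1 h
    obtain ⟨y₂, h2, h3⟩ := isWalk_append.1 h2
    have ha : s a = y₁ := h2.2.1
    have hb : s b = y₂ := h3.2.1
    obtain rfl : y₁ = y₂ := by rw [← ha, ← hb, hab]
    have c := (ih _ (by subst hn; simp only [List.length_append, List.length_cons]; omega) h2 rfl).2 rfl
    have d := ih _ (by subst hn; simp only [List.length_append, List.length_cons]; omega) (isWalk_append.2 ⟨y₁, h1, h3⟩) rfl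
    simp only [List.map_append, List.sum_append] at c d ⊢
    exact ⟨by linarith, fun e => by linarith [d.2 e]⟩

/-- Shortest walk distances form a potential. -/
theorem exists_potential [Fintype V] [Finite A] {k : A → ℤ}
    (hs : ∀ x l, IsWalk s t r x l x → (l.map s).Nodup → 0 ≤ (l.map k).sum) :
    ∃ π : V → ℤ, ∀ a, r a → π (t a) ≤ π (s a) + k a := by
  have := Fintype.ofFinite A
  have hM : ∀ a, -(∑ a, |k a|) ≤ k a := fun a => by
    have := Finset.single_le_sum (f := fun a => |k a|) (fun a _ => abs_nonneg _) (Finset.mem_univ a)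
    have h2 := neg_abs_le (k a)
    linarith
  let D : V → Set ℤ := fun y => {c | ∃ x l, IsWalk s t r x l y ∧ (l.map k).sum = c}
  have hb : ∀ y, BddBelow (D y) := fun y => by
    refine ⟨-(Fintype.card V * ∑ a, |k a|), ?_⟩
    rintro c ⟨x, l, h, rfl⟩
    exact (h.cost_bound (Finset.sum_nonneg fun _ _ => abs_nonneg _) (fun a _ => hM a) hs).1
  have hne : ∀ y, (D y).Nonempty := fun y => ⟨0, y, [], rfl, rfl⟩
  refine ⟨fun y => sInf (D y), fun a ha => ?_⟩
  obtain ⟨x, l, h, hc⟩ := Int.csInf_mem (hne (s a)) (hb (s a))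
  change sInf (D (t a)) ≤ sInf (D (s a)) + k a
  rw [← hc]
  exact csInf_le (hb _) ⟨x, l ++ [a], isWalk_append.2 ⟨_, h, ha, rfl, rfl⟩, by simp⟩

end Walk

namespace CapDigraph

variable {V : Type u} {E : Type v} [Fintype V] [Fintype E] (G : CapDigraph V E)

/-! ### Optimal integral flows -/

/-- The pairing of an integral edge vector `g` with a vertex potential `q`. Two vectors have the
same net outflow at each vertex if and only if they have the same pairing with each potential,
since `G.gain g q = -∑ x, q x * netOut g x`. -/
def gain (g : E → ℤ) (q : V → ℤ) : ℤ := ∑ e, g e * (q (G.tgt e) - q (G.src e))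

/-- Integral minimum cost flow with complementary slackness. The second pair of conditions says
that `π` is a potential of the residual graph of `g`. -/
theorem exists_optimal_flow (cost ub g₀ : E → ℤ) (h0 : ∀ e, 0 ≤ g₀ e) (h1 : ∀ e, g₀ e ≤ ub e) :
    ∃ (g : E → ℤ) (π : V → ℤ), (∀ e, 0 ≤ g e) ∧ (∀ e, g e ≤ ub e) ∧ G.gain g = G.gain g₀ ∧
      (∀ e, g e < ub e → π (G.tgt e) ≤ π (G.src e) + cost e) ∧
      (∀ e, 0 < g e → π (G.src e) + cost e ≤ π (G.tgt e)) := by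
  classical
  have hfin : {g : E → ℤ | g ∈ Set.Icc 0 ub ∧ G.gain g = G.gain g₀}.Finite :=
    (Set.finite_Icc (0 : E → ℤ) ub).subset fun g hg => hg.1
  obtain ⟨g, ⟨⟨hg0, hg1⟩, hgg⟩, hmin⟩ := Set.exists_min_image _ (fun g => ∑ e, cost e * g e) hfin
    ⟨g₀, ⟨fun e => h0 e, fun e => h1 e⟩, rfl⟩
  -- The arc `(e, true)` of the residual graph is `e`, and `(e, false)` is its reversal.
  let s : E × Bool → V := fun a => if a.2 then G.src a.1 else G.tgt a.1
  let t : E × Bool → V := fun a => if a.2 then G.tgt a.1 else G.src a.1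
  let r : E × Bool → Prop := fun a => if a.2 then g a.1 < ub a.1 else 0 < g a.1
  let k : E × Bool → ℤ := fun a => if a.2 then cost a.1 else -cost a.1
  let σ : E × Bool → E → ℤ := fun a e => if a.1 = e then (if a.2 then 1 else -1) else 0
  have hσ : ∀ (l : List (E × Bool)) (w : E → ℤ),
      ∑ e, w e * (l.map fun a => σ a e).sum =
        (l.map fun a => if a.2 then w a.1 else -w a.1).sum := by
    intro l w
    induction l with
    | nil => simp
    | cons a l ih =>
      simp only [List.map_cons, List.sum_cons, mul_add, Finset.sum_add_distrib, ih]
      congr 1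
      simp only [σ, mul_ite, mul_zero, Finset.sum_ite_eq, Finset.mem_univ, if_true]
      split_ifs <;> simp
  have hs : ∀ x l, IsWalk s t r x l x → (l.map s).Nodup → 0 ≤ (l.map k).sum := by
    intro x l hl hnd
    have hnd' : l.Nodup := hnd.of_map _
    have hcount : ∀ e, (l.map fun a => σ a e).sum =
        (if (e, true) ∈ l then 1 else 0) - (if (e, false) ∈ l then 1 else 0) := by
      intro e
      have : ∀ l : List (E × Bool), (l.map fun a => σ a e).sum =
          (l.count (e, true) : ℤ) - l.count (e, false) := by
        intro l
        induction l with
        | nil => simp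
        | cons a l ih =>
          obtain ⟨e', b⟩ := a
          rw [List.map_cons, List.sum_cons, ih, List.count_cons, List.count_cons]
          by_cases he : e' = e <;> cases b <;> simp [σ, he] <;> ring
      rw [this, hnd'.count, hnd'.count]
      push_cast
      rfl
    have hT : ∀ e, (e, true) ∈ l → g e < ub e := fun e he => by
      simpa [r] using hl.forall_mem _ he
    have hB : ∀ e, (e, false) ∈ l → 0 < g e := fun e he => by
      simpa [r] using hl.forall_mem _ he
    have hle := hmin (fun e => g e + (l.map fun a => σ a e).sum) ⟨⟨fun e => ?_, fun e => ?_⟩, ?_⟩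
    · simp only [mul_add, Finset.sum_add_distrib, hσ l cost] at hle
      have : (l.map k).sum = (l.map fun a => if a.2 then cost a.1 else -cost a.1).sum := rfl
      linarith
    · have h3 := hB e
      have h4 := hg0 e
      simp only [Pi.zero_apply, hcount] at h4 ⊢
      by_cases h5 : (e, true) ∈ l <;> by_cases h6 : (e, false) ∈ l <;>
        simp only [h5, h6, if_true, if_false, forall_const] at h3 ⊢ <;> linarith
    · have h3 := hT e
      have h4 := hg1 e
      simp only [hcount]
      by_cases h5 : (e, true) ∈ l <;> by_cases h6 : (e, false) ∈ l <;>
        simp only [h5, h6, if_true, if_false, forall_const] at h3 ⊢ <;> linarith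
    · rw [← hgg]
      funext q
      have h5 := hσ l fun e => q (G.tgt e) - q (G.src e)
      have h6 := hl.sum_sub q
      have h7 : (l.map fun a => if a.2 then q (G.tgt a.1) - q (G.src a.1)
          else -(q (G.tgt a.1) - q (G.src a.1))).sum = (l.map fun a => q (t a) - q (s a)).sum := by
        congr 2
        funext a
        simp only [s, t]
        split_ifs <;> ring
      rw [h7, h6, sub_self] at h5
      simp only [gain, add_mul, Finset.sum_add_distrib]
      rw [add_eq_left, ← h5]
      exact Finset.sum_congr rfl fun e _ => mul_comm _ _
  obtain ⟨π, hπ⟩ := exists_potential (k := k) hs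
  refine ⟨g, π, hg0, hg1, hgg, fun e he => ?_, fun e he => ?_⟩
  · simpa [s, t, k, r] using hπ (e, true) (by simpa [r] using he)
  · have := hπ (e, false) (by simpa [r] using he)
    simp only [s, t, k, Bool.false_eq_true, if_false] at this
    linarith

/-! ### Volumes -/

open Classical in
/-- The volume as a sum over edges; self-loops do not contribute. -/
theorem vol_eq_sum_edges (F : Set E) (S : Set V) :
    G.vol F S = ∑ e, if e ∈ F ∧ G.src e ≠ G.tgt e then
      G.cap e * ((if G.src e ∈ S then 1 else 0) + (if G.tgt e ∈ S then 1 else 0)) else 0 := by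
  have h1 : ∀ x, (if x ∈ S then G.deg F x else 0) = ∑ e,
      ((if x = G.src e then (if e ∈ F ∧ G.src e ≠ G.tgt e ∧ G.src e ∈ S then G.cap e else 0) else 0)
      + if x = G.tgt e then
          (if e ∈ F ∧ G.src e ≠ G.tgt e ∧ G.tgt e ∈ S then G.cap e else 0) else 0) := by
    intro x
    by_cases hx : x ∈ S
    · simp only [hx, if_true, deg, cutCap, ← Finset.sum_add_distrib]
      refine Finset.sum_congr rfl fun e _ => ?_
      congr 1
      · by_cases h : x = G.src e
        · subst h; simp [hx, eq_comm]
        · simp [h, Ne.symm h]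
      · by_cases h : x = G.tgt e
        · subst h; simp [hx]
        · simp [h, Ne.symm h]
    · simp only [hx, if_false]
      symm
      refine Finset.sum_eq_zero fun e _ => ?_
      split_ifs <;> simp_all
  rw [vol, Finset.sum_congr rfl fun x _ => h1 x, Finset.sum_comm]
  refine Finset.sum_congr rfl fun e _ => ?_
  rw [Finset.sum_add_distrib, Finset.sum_ite_eq', Finset.sum_ite_eq']
  simp only [Finset.mem_univ, if_true]
  split_ifs <;> simp_all
  omega

theorem vol_union {F : Set E} {S T : Set V} (h : Disjoint S T) :
    G.vol F (S ∪ T) = G.vol F S + G.vol F T := by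
  classical
  simp only [vol, ← Finset.sum_add_distrib]
  refine Finset.sum_congr rfl fun x _ => ?_
  have : x ∈ S → x ∉ T := fun hx => Set.disjoint_left.1 h hx
  by_cases h1 : x ∈ S <;> by_cases h2 : x ∈ T <;> simp_all

theorem vol_mono {F : Set E} {S T : Set V} (h : S ⊆ T) : G.vol F S ≤ G.vol F T := by
  classical
  refine Finset.sum_le_sum fun x _ => ?_
  have := @h x
  split_ifs <;> simp_all

theorem vol_le_two_mul_sum (F : Set E) (S : Set V) : G.vol F S ≤ 2 * ∑ e, G.cap e := by
  classical
  rw [vol_eq_sum_edges, Finset.mul_sum]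
  refine Finset.sum_le_sum fun e _ => ?_
  split_ifs <;> omega

/-- The capacity of a set of edges of `F`, none of them a self-loop, all with an end in `S`. -/
theorem sum_cap_le_vol {F : Set E} {S : Set V} (p : E → Prop) [DecidablePred p]
    (hp : ∀ e, p e → e ∈ F ∧ G.src e ≠ G.tgt e ∧ (G.src e ∈ S ∨ G.tgt e ∈ S)) :
    ∑ e, (if p e then G.cap e else 0) ≤ G.vol F S := by
  classical
  rw [vol_eq_sum_edges]
  refine Finset.sum_le_sum fun e _ => ?_
  by_cases h : p e
  · obtain ⟨h1, h2, h3⟩ := hp e h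
    rw [if_pos h, if_pos ⟨h1, h2⟩]
    rcases h3 with h3 | h3 <;> simp only [h3, if_true]
    · exact Nat.le_mul_of_pos_right _ (by omega)
    · exact Nat.le_mul_of_pos_right _ (by omega)
  · simp [h]

/-! ### Geometric growth -/

theorem pow_le_of_growth {φ : ℝ} (hφ : 0 < φ) {N : ℕ} {h : ℕ → ℝ} (h0 : 1 ≤ h 0)
    (hg : ∀ k < N, (1 + φ / 2) * h k ≤ h (k + 1)) : (1 + φ / 2) ^ N ≤ h N := by
  induction N with
  | zero => simpa using h0
  | succ N ih =>
    have := ih fun k hk => hg k (by omega)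
    calc (1 + φ / 2) ^ (N + 1) = (1 + φ / 2) * (1 + φ / 2) ^ N := by ring
      _ ≤ (1 + φ / 2) * h N := by gcongr
      _ ≤ h (N + 1) := hg N (by omega)

/-- Ball growing in terms of a threshold function `A`, the volume up to the threshold `r`. While
neither side of `r` has volume at most `2 * θ / φ`, the smaller side grows by the factor `1 + φ / 2`
when the threshold moves by `m`; `N` such steps from either end would exceed the total volume `U`.
So the thresholds with more than `2 * θ / φ` on both sides form a window of length `2 * N * m`. -/
theorem exists_window {φ θ : ℝ} (hφ : 0 < φ) (hθ : 0 ≤ θ) {A : ℤ → ℕ} {U : ℕ} {m : ℤ}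
    (hm : 1 ≤ m) {N : ℕ} (hA : Monotone A) (hU : ∀ r, A r ≤ U) (htop : ∃ r, A r = U)
    (hbot : ∃ r, A r = 0) (hN : (U : ℝ) < (1 + φ / 2) ^ N)
    (hlow : ∀ r, φ * min (A r : ℝ) (U - A r) ≤ θ + (A (r + m) - A r))
    (hhigh : ∀ r, φ * min (A r : ℝ) (U - A r) ≤ θ + (A r - A (r - m))) :
    ∃ r₀ r₁ : ℤ, r₁ - r₀ ≤ 2 * N * m ∧ r₀ ≤ r₁ ∧ (A (r₀ - 1) : ℝ) ≤ 2 * θ / φ ∧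
      (U - A r₁ : ℝ) ≤ 2 * θ / φ := by
  have hθ' : 0 ≤ 2 * θ / φ := by positivity
  rcases Nat.eq_zero_or_pos U with rfl | hUpos
  · have : ∀ r, A r = 0 := fun r => Nat.le_zero.1 (hU r)
    exact ⟨0, 0, by simp; positivity, le_rfl, by simpa [this] using hθ', by simpa [this] using hθ'⟩
  -- `c` is the first threshold up to which more than half of the volume lies.
  obtain ⟨c, hc, hcmin⟩ : ∃ c, U < 2 * A c ∧ ∀ r, U < 2 * A r → c ≤ r := by
    obtain ⟨b, hb⟩ := hbot
    refine Int.exists_least_of_bdd (P := fun r => U < 2 * A r) ⟨b, fun r hr => ?_⟩ ?_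
    · by_contra hlt
      have := hA (le_of_lt (not_le.1 hlt))
      omega
    · obtain ⟨t, ht⟩ := htop
      exact ⟨t, by omega⟩
  refine ⟨c - m * N, c + m * N, by linarith, ?_, ?_, ?_⟩
  · nlinarith
  · by_contra! hlt
    have hstep : ∀ k < N, (1 + φ / 2) * (A (c - m * N - 1 + m * k) : ℝ) ≤
        A (c - m * N - 1 + m * (k + 1 : ℕ)) := by
      intro k hk
      have hr : c - m * N - 1 + m * k < c := by
        have : m * k ≤ m * N := by gcongr
        linarith
      have hhalf : 2 * A (c - m * N - 1 + m * k) ≤ U := by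
        by_contra! h
        exact absurd (hcmin _ h) (not_le.2 hr)
      have hhalf' : 2 * (A (c - m * N - 1 + m * k) : ℝ) ≤ U := by exact_mod_cast hhalf
      have hge : (A (c - m * N - 1) : ℝ) ≤ A (c - m * N - 1 + m * k) := by
        exact_mod_cast hA (by nlinarith)
      have h1 := hlow (c - m * N - 1 + m * k)
      rw [min_eq_left (by linarith)] at h1
      have h2 : c - m * N - 1 + m * k + m = c - m * N - 1 + m * (k + 1 : ℕ) := by push_cast; ring
      rw [h2] at h1
      have h3 := (div_lt_iff₀ hφ).1 (lt_of_lt_of_le hlt hge)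
      nlinarith
    -- Volumes are integers, so a positive one is at least `1`.
    have h0 : (1 : ℝ) ≤ A (c - m * N - 1 + m * (0 : ℕ)) := by
      have : (0 : ℝ) < A (c - m * N - 1) := lt_of_le_of_lt hθ' hlt
      simp only [Nat.cast_zero, mul_zero, add_zero]
      exact_mod_cast this
    have h4 := pow_le_of_growth hφ (h := fun k => (A (c - m * N - 1 + m * k) : ℝ)) h0 hstep
    have h5 : (A (c - m * N - 1 + m * N) : ℝ) ≤ U := by exact_mod_cast hU _
    linarith
  · by_contra! hlt
    have hstep : ∀ k < N, (1 + φ / 2) * (U - A (c + m * N - m * k) : ℝ) ≤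
        U - A (c + m * N - m * (k + 1 : ℕ)) := by
      intro k hk
      have hr : c ≤ c + m * N - m * k := by
        have : m * k ≤ m * N := by gcongr
        linarith
      have hhalf : (U : ℝ) ≤ 2 * A (c + m * N - m * k) := by
        have := hA hr
        exact_mod_cast (by omega : U ≤ 2 * A (c + m * N - m * k))
      have hge : (A (c + m * N - m * k) : ℝ) ≤ A (c + m * N) := by
        exact_mod_cast hA (by nlinarith)
      have h1 := hhigh (c + m * N - m * k)
      rw [min_eq_right (by linarith)] at h1
      have h2 : c + m * N - m * k - m = c + m * N - m * (k + 1 : ℕ) := by push_cast; ring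
      rw [h2] at h1
      have h3 := (div_lt_iff₀ hφ).1 hlt
      nlinarith
    have h0 : (1 : ℝ) ≤ U - A (c + m * N - m * (0 : ℕ)) := by
      have h : (A (c + m * N) : ℝ) < U := by linarith
      simp only [Nat.cast_zero, mul_zero, sub_zero]
      have h' : A (c + m * N) + 1 ≤ U := by exact_mod_cast h
      have h'' : (A (c + m * N) : ℝ) + 1 ≤ U := by exact_mod_cast h'
      linarith
    have h4 := pow_le_of_growth hφ (h := fun k => (U - A (c + m * N - m * k) : ℝ)) h0 hstep
    have h5 : (0 : ℝ) ≤ A (c + m * N - m * N) := by positivity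
    linarith

/-! ### One strongly connected component -/

theorem vol_level_add {F : Set E} {C : Set V} (π : V → ℤ) {a b : ℤ} (h : a ≤ b) :
    G.vol F {x | x ∈ C ∧ π x ≤ b} =
      G.vol F {x | x ∈ C ∧ π x ≤ a} + G.vol F {x | x ∈ C ∧ a < π x ∧ π x ≤ b} := by
  rw [← vol_union]
  · congr 1
    ext x
    simp only [Set.mem_ofPred_eq, Set.mem_union]
    grind
  · rw [Set.disjoint_left]
    rintro x ⟨-, h1⟩ ⟨-, h2, -⟩
    omega

theorem gain_nonneg {V : Type u} {E : Type v} (G : CapDigraph V E) {g : E → ℤ} {q : V → ℤ}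
    (hg : ∀ e, 0 ≤ g e) (hq : ∀ e, 0 < g e → q (G.src e) ≤ q (G.tgt e)) (e : E) :
    0 ≤ g e * (q (G.tgt e) - q (G.src e)) := by
  rcases (hg e).eq_or_lt with h | h
  · simp [← h]
  · exact mul_nonneg h.le (sub_nonneg.2 (hq e h))

/-- An expanding component has large cuts at the level sets of `π`. -/
theorem expanding_level_cut {φ : ℝ} {H F : Set E} (hexp : G.IsExpanding φ H F) {C : Set V}
    (hC : G.IsSCC H C) (π : V → ℤ) (r : ℤ) :
    φ * min (G.vol F {x | x ∈ C ∧ π x ≤ r} : ℝ) (G.vol F C - G.vol F {x | x ∈ C ∧ π x ≤ r}) ≤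
      G.cutCap H {x | x ∈ C ∧ π x ≤ r} (C \ {x | x ∈ C ∧ π x ≤ r}) := by
  set S : Set V := {x | x ∈ C ∧ π x ≤ r} with hS
  have hSC : S ⊆ C := fun x hx => hx.1
  have hadd : G.vol F C = G.vol F S + G.vol F (C \ S) := by
    rw [← vol_union _ Set.disjoint_sdiff_right, Set.union_sdiff_cancel hSC]
  have hsub : (G.vol F C - G.vol F S : ℝ) = G.vol F (C \ S) := by
    rw [hadd]; push_cast; ring
  have hzero : G.vol F ∅ = 0 := by simp [vol]
  rw [hsub]
  rcases S.eq_empty_or_nonempty with h | h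
  · rw [h, hzero]
    simp
  · by_cases h' : S = C
    · rw [h', Set.sdiff_self, hzero]
      simp
    · have := hexp C hC S hSC h h'
      rw [IsSparseCut, not_lt] at this
      exact this.trans (min_le_left _ _)

/-- Bound on the flow on the edges of `F` in the component `C`, for a flow `g` that is optimal
with respect to the cost `m` on these edges: `π` is an optimal potential and `hsat`, `hsatF`,
`hmono`, `hmonoF` are what complementary slackness provides. The number `P` bounds the amount of
flow that crosses any level of `π`.

An edge across the level cut at `r` is either saturated, and there is little capacity of such edges
since at most `P` flow crosses the cut, or it is in `F` and has its head at most `m` above its tail.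
So expansion makes the volume of the level sets grow geometrically from both ends, and all but a
volume of order `P / (φ * κ)` lies in a window of length `2 * N * m`. -/
theorem component_bound {φ : ℝ} (hφ : 0 < φ) {H F : Set E} (hexp : G.IsExpanding φ H F)
    {C : Set V} (hC : G.IsSCC H C) (hF : ∀ e ∈ F, G.src e ∈ C → G.tgt e ∈ C) {κ : ℝ} (hκ : 0 < κ)
    {g : E → ℤ} {π : V → ℤ} {m : ℤ} {P B : ℝ} {N : ℕ} (hm : 1 ≤ m) (hB : 0 ≤ B) (hP0 : 0 ≤ P)
    (hg : ∀ e, 0 ≤ g e) (hup : ∀ e ∈ F, (g e : ℝ) ≤ B * κ * G.cap e)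
    (hsat : ∀ e ∈ H, e ∉ F → π (G.src e) < π (G.tgt e) → κ * G.cap e ≤ g e)
    (hsatF : ∀ e ∈ H, e ∈ F → G.src e ∈ C → π (G.src e) + m < π (G.tgt e) → κ * G.cap e ≤ g e)
    (hmono : ∀ e, 0 < g e → π (G.src e) ≤ π (G.tgt e))
    (hmonoF : ∀ e ∈ F, G.src e ∈ C → 0 < g e → π (G.src e) + m ≤ π (G.tgt e))
    (hP : ∀ (q : V → ℤ) (W : ℤ), (∀ x, 0 ≤ q x ∧ q x ≤ W) → (G.gain g q : ℝ) ≤ W * P)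
    (hN : (G.vol F C : ℝ) < (1 + φ / 2) ^ N) (p : E → Prop) [DecidablePred p]
    (hp : ∀ e, p e → e ∈ F ∧ G.src e ∈ C) :
    ∑ e, (if p e then (g e : ℝ) else 0) ≤ P * (4 * B / φ + 2 * N) := by
  classical
  set A : ℤ → ℕ := fun r => G.vol F {x | x ∈ C ∧ π x ≤ r} with hA
  have hm0 : (0 : ℝ) < m := by exact_mod_cast (by omega : 0 < m)
  have hbetween : ∀ r, ∃ Q : ℝ, φ * min (A r : ℝ) (G.vol F C - A r) ≤ P / κ + Q ∧
      Q ≤ A (r + m) - A r ∧ Q ≤ A r - A (r - m) := by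
    intro r
    set S : Set V := {x | x ∈ C ∧ π x ≤ r} with hS
    let t : E → Prop := fun e => e ∈ H ∧ G.src e ∈ S ∧ G.tgt e ∈ C \ S
    let u : E → Prop := fun e => t e ∧ e ∈ F ∧ π (G.tgt e) ≤ π (G.src e) + m
    have ht : ∀ e, t e → π (G.src e) ≤ r ∧ r < π (G.tgt e) := fun e he =>
      ⟨he.2.1.2, not_le.1 fun h => he.2.2.2 ⟨he.2.2.1, h⟩⟩
    have hne : ∀ e, t e → G.src e ≠ G.tgt e := fun e he h => by
      have := ht e he
      rw [h] at this
      omega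
    refine ⟨((∑ e, if u e then G.cap e else 0 : ℕ) : ℝ), ?_, ?_, ?_⟩
    · refine (G.expanding_level_cut hexp hC π r).trans ?_
      -- the saturated edges of the cut
      have h1 : κ * ((∑ e, if t e ∧ ¬ u e then G.cap e else 0 : ℕ) : ℝ) ≤ P := by
        have hq := hP (fun x => if r < π x then 1 else 0) 1 (fun x => by split_ifs <;> simp)
        rw [Int.cast_one, one_mul] at hq
        refine le_trans ?_ hq
        rw [gain]
        push_cast
        rw [Finset.mul_sum]
        refine Finset.sum_le_sum fun e _ => ?_
        by_cases he : t e ∧ ¬ u e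
        · obtain ⟨he1, he2⟩ := he
          have h2 := ht e he1
          rw [if_pos ⟨he1, he2⟩, if_pos h2.2, if_neg (not_lt.2 h2.1)]
          simp only [sub_zero, mul_one]
          by_cases heF : e ∈ F
          · refine hsatF e he1.1 heF he1.2.1.1 ?_
            by_contra! h3
            exact he2 ⟨he1, heF, h3⟩
          · exact hsat e he1.1 heF (by omega)
        · rw [if_neg he, mul_zero]
          have := G.gain_nonneg (q := fun x => if r < π x then 1 else 0) hg (fun e he => by
            have := hmono e he
            split_ifs <;> omega) e
          exact_mod_cast this
      have h2 : G.cutCap H S (C \ S) = (∑ e, if t e ∧ ¬ u e then G.cap e else 0) +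
          ∑ e, if u e then G.cap e else 0 := by
        rw [cutCap, ← Finset.sum_add_distrib]
        refine Finset.sum_congr rfl fun e _ => ?_
        by_cases h : t e
        · rw [if_pos (show e ∈ H ∧ G.src e ∈ S ∧ G.tgt e ∈ C \ S from h)]
          by_cases h' : u e <;> simp [h, h']
        · rw [if_neg (show ¬ (e ∈ H ∧ G.src e ∈ S ∧ G.tgt e ∈ C \ S) from h)]
          have : ¬ u e := fun h' => h h'.1
          simp [h, this]
      rw [h2]
      push_cast
      push_cast at h1
      gcongr
      rw [le_div_iff₀ hκ]
      linarith
    · have h1 := G.vol_level_add (F := F) (C := C) π (show r ≤ r + m by omega)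
      have h2 := G.sum_cap_le_vol (F := F) (S := {x | x ∈ C ∧ r < π x ∧ π x ≤ r + m}) u
        fun e he => ⟨he.2.1, hne e he.1, Or.inr ⟨he.1.2.2.1, by
          have := ht e he.1; have := he.2.2; constructor <;> omega⟩⟩
      have h3 : (∑ e, if u e then G.cap e else 0) + A r ≤ A (r + m) := by
        simp only [hA]; omega
      have h4 : ((∑ e, if u e then G.cap e else 0 : ℕ) : ℝ) + A r ≤ A (r + m) := by
        exact_mod_cast h3
      linarith
    · have h1 := G.vol_level_add (F := F) (C := C) π (show r - m ≤ r by omega)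
      have h2 := G.sum_cap_le_vol (F := F) (S := {x | x ∈ C ∧ r - m < π x ∧ π x ≤ r}) u
        fun e he => ⟨he.2.1, hne e he.1, Or.inl ⟨he.1.2.1.1, by
          have := ht e he.1; have := he.2.2; constructor <;> omega⟩⟩
      have h3 : (∑ e, if u e then G.cap e else 0) + A (r - m) ≤ A r := by
        simp only [hA]; omega
      have h4 : ((∑ e, if u e then G.cap e else 0 : ℕ) : ℝ) + A (r - m) ≤ A r := by
        exact_mod_cast h3
      linarith
  have hAmono : Monotone A := fun a b hab => G.vol_mono fun x hx => ⟨hx.1, hx.2.trans hab⟩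
  have hbd : ∀ x, |π x| ≤ ∑ y, |π y| := fun x =>
    Finset.single_le_sum (f := fun y => |π y|) (fun y _ => abs_nonneg _) (Finset.mem_univ x)
  obtain ⟨r₀, r₁, hlen, hr, hlo, hhi⟩ := exists_window (A := A) (U := G.vol F C) hφ
    (div_nonneg hP0 hκ.le) hm hAmono (fun r => G.vol_mono fun x hx => hx.1)
    ⟨∑ y, |π y|, by
      simp only [hA]
      congr 1
      ext x
      exact ⟨fun h => h.1, fun h => ⟨h, (le_abs_self _).trans (hbd x)⟩⟩⟩
    ⟨-(∑ y, |π y|) - 1, by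
      have : {x | x ∈ C ∧ π x ≤ -(∑ y, |π y|) - 1} = ∅ := by
        ext x
        simp only [Set.mem_ofPred_eq, Set.mem_empty_iff_false, iff_false, not_and]
        intro _
        have := hbd x
        have := neg_abs_le (π x)
        omega
      simp only [hA, this]
      simp [vol]⟩ hN
    (fun r => by obtain ⟨Q, h1, h2, -⟩ := hbetween r; linarith)
    (fun r => by obtain ⟨Q, h1, -, h2⟩ := hbetween r; linarith)
  -- The truncation of `π` to the window.
  let q : V → ℤ := fun x => min (max (π x) r₀) r₁ - r₀
  have hq := hP q (r₁ - r₀) (fun x => by simp only [q]; omega)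
  let lo : E → Prop := fun e => e ∈ F ∧ G.src e ≠ G.tgt e ∧ G.src e ∈ C ∧ π (G.src e) ≤ r₀ - 1
  let hi : E → Prop := fun e => e ∈ F ∧ G.src e ≠ G.tgt e ∧ G.tgt e ∈ C ∧ r₁ < π (G.tgt e)
  have hcaplo : ((∑ e, if lo e then G.cap e else 0 : ℕ) : ℝ) ≤ 2 * (P / κ) / φ := by
    refine le_trans ?_ hlo
    exact_mod_cast G.sum_cap_le_vol lo fun e he => ⟨he.1, he.2.1, Or.inl he.2.2⟩
  have hcaphi : ((∑ e, if hi e then G.cap e else 0 : ℕ) : ℝ) ≤ 2 * (P / κ) / φ := by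
    refine le_trans ?_ hhi
    have h1 := G.vol_level_add (F := F) (C := C) π (show r₁ ≤ max r₁ (∑ y, |π y|) by omega)
    have h2 := G.sum_cap_le_vol (F := F)
      (S := {x | x ∈ C ∧ r₁ < π x ∧ π x ≤ max r₁ (∑ y, |π y|)}) hi
      fun e he => ⟨he.1, he.2.1, Or.inr ⟨he.2.2.1, he.2.2.2,
        le_max_of_le_right ((le_abs_self _).trans (hbd _))⟩⟩
    have h3 := G.vol_mono (F := F) (S := {x | x ∈ C ∧ π x ≤ max r₁ (∑ y, |π y|)}) (T := C)
      fun x hx => hx.1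
    have h4 : (∑ e, if hi e then G.cap e else 0) + A r₁ ≤ G.vol F C := by
      simp only [hA]; omega
    have h5 : ((∑ e, if hi e then G.cap e else 0 : ℕ) : ℝ) + A r₁ ≤ G.vol F C := by
      exact_mod_cast h4
    linarith
  have hedge : ∀ e, m * (if p e then (g e : ℝ) else 0) ≤
      m * (B * κ * (if lo e then G.cap e else 0 : ℕ)) +
      m * (B * κ * (if hi e then G.cap e else 0 : ℕ)) +
      (g e * (q (G.tgt e) - q (G.src e)) : ℤ) := by
    intro e
    have h1 : 0 ≤ g e * (q (G.tgt e) - q (G.src e)) := G.gain_nonneg hg (fun e he => by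
      have := hmono e he
      simp only [q]
      omega) e
    have h1' : (0 : ℝ) ≤ (g e * (q (G.tgt e) - q (G.src e)) : ℤ) := by exact_mod_cast h1
    have h2 : (0 : ℝ) ≤ m * (B * κ * (if lo e then G.cap e else 0 : ℕ)) := by positivity
    have h3 : (0 : ℝ) ≤ m * (B * κ * (if hi e then G.cap e else 0 : ℕ)) := by positivity
    by_cases h4 : p e ∧ 0 < g e
    · obtain ⟨h4, h5⟩ := h4
      obtain ⟨h6, h7⟩ := hp e h4
      have h8 := hmonoF e h6 h7 h5
      have h9 : G.src e ≠ G.tgt e := fun h => by rw [h] at h8; omega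
      rw [if_pos h4]
      have h10 : m * (g e : ℝ) ≤ m * (B * κ * G.cap e) := by gcongr; exact hup e h6
      by_cases h11 : lo e
      · rw [if_pos h11] at h2 ⊢
        linarith
      by_cases h12 : hi e
      · rw [if_pos h12] at h3 ⊢
        linarith
      have h13 : r₀ ≤ π (G.src e) := by
        by_contra! h
        exact h11 ⟨h6, h9, h7, by omega⟩
      have h14 : π (G.tgt e) ≤ r₁ := by
        by_contra! h
        exact h12 ⟨h6, h9, hF e h6 h7, h⟩
      have h15 : m ≤ q (G.tgt e) - q (G.src e) := by
        simp only [q]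
        omega
      have h16 : m * g e ≤ g e * (q (G.tgt e) - q (G.src e)) := by nlinarith
      have h17 : (m : ℝ) * g e ≤ (g e * (q (G.tgt e) - q (G.src e)) : ℤ) := by exact_mod_cast h16
      linarith
    · have : (if p e then (g e : ℝ) else 0) = 0 := by
        split_ifs with h
        · have := hg e
          have : g e = 0 := by
            by_contra h'
            exact h4 ⟨h, by omega⟩
          simp [this]
        · rfl
      rw [this, mul_zero]
      linarith
  have hsum := Finset.sum_le_sum fun e (_ : e ∈ Finset.univ) => hedge e
  rw [← Finset.mul_sum, Finset.sum_add_distrib, Finset.sum_add_distrib, ← Finset.mul_sum,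
    ← Finset.mul_sum, ← Finset.mul_sum, ← Finset.mul_sum, ← Nat.cast_sum, ← Nat.cast_sum,
    ← Int.cast_sum] at hsum
  change _ ≤ _ + (G.gain g q : ℝ) at hsum
  have hlen' : ((r₁ - r₀ : ℤ) : ℝ) ≤ 2 * N * m := by exact_mod_cast hlen
  have hqP : ((r₁ - r₀ : ℤ) : ℝ) * P ≤ 2 * N * m * P := by gcongr
  have hlo' := mul_le_mul_of_nonneg_left hcaplo (show 0 ≤ m * (B * κ) by positivity)
  have hhi' := mul_le_mul_of_nonneg_left hcaphi (show 0 ≤ m * (B * κ) by positivity)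
  have heq : m * (B * κ) * (2 * (P / κ) / φ) = m * (2 * B * P / φ) := by
    field_simp
  rw [heq] at hlo' hhi'
  refine le_of_mul_le_mul_left ?_ hm0
  calc _ ≤ m * (2 * B * P / φ) + m * (2 * B * P / φ) + 2 * N * m * P := by linarith
    _ = _ := by ring

/-! ### Passing through the levels of the hierarchy -/

/-- The strongly connected component of `x` in `(V, H)`. -/
def scc {V : Type u} {E : Type v} (G : CapDigraph V E) (H : Set E) (x : V) : Set V :=
  {y | G.Reach H x y ∧ G.Reach H y x}

section SCC

variable {V : Type u} {E : Type v} (G : CapDigraph V E)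

theorem isSCC_scc (H : Set E) (x : V) : G.IsSCC H (G.scc H x) := ⟨x, rfl⟩

theorem mem_scc_self (H : Set E) (x : V) : x ∈ G.scc H x :=
  ⟨Relation.ReflTransGen.refl, Relation.ReflTransGen.refl⟩

theorem mem_scc_comm {H : Set E} {x y : V} : x ∈ G.scc H y ↔ y ∈ G.scc H x :=
  and_comm

theorem IsSCC.eq_scc {G : CapDigraph V E} {H : Set E} {C : Set V} (hC : G.IsSCC H C) {x : V}
    (hx : x ∈ C) : C = G.scc H x := by
  obtain ⟨z, rfl⟩ := hC
  ext y
  exact ⟨fun hy => ⟨hx.2.trans hy.1, hy.2.trans hx.1⟩, fun hy => ⟨hx.1.trans hy.1, hy.2.trans hx.2⟩⟩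

end SCC

/-- One level of the hierarchy: rerouting with congestion `κ` in `(V, H)` makes the flow on `F`
short, where an edge has the size of its component as its length. -/
theorem exists_level_step {φ : ℝ} (hφ : 0 < φ) {H F : Set E} (hexp : G.IsExpanding φ H F)
    (hFin : ∀ e ∈ F, ∃ C, G.IsSCC H C ∧ G.src e ∈ C ∧ G.tgt e ∈ C) {κ : ℕ} (hκ : 0 < κ)
    {g₀ : E → ℤ} (hg₀ : ∀ e, 0 ≤ g₀ e) {B P : ℝ} (hB : 0 ≤ B) (hP0 : 0 ≤ P)
    (hup : ∀ e, (g₀ e + κ * G.cap e : ℝ) ≤ B * κ * G.cap e)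
    (hP : ∀ (q : V → ℤ) (W : ℤ), (∀ x, 0 ≤ q x ∧ q x ≤ W) → (G.gain g₀ q : ℝ) ≤ W * P) {N : ℕ}
    (hN : ((2 * ∑ e, G.cap e : ℕ) : ℝ) < (1 + φ / 2) ^ N) :
    ∃ g : E → ℤ, (∀ e, 0 ≤ g e) ∧ G.gain g = G.gain g₀ ∧ (∀ e, g e ≤ g₀ e + κ * G.cap e) ∧
      (∀ e ∉ H, g e ≤ g₀ e) ∧ ∀ (p : E → Prop) [DecidablePred p], (∀ e, p e → e ∈ F) →
        ∑ e, (if p e then ((G.scc H (G.src e)).ncard * g e : ℝ) else 0) ≤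
          Fintype.card V * (P * (4 * B / φ + 2 * N)) := by
  classical
  obtain ⟨g, π, hg, hub, hgain, hres, hrev⟩ := G.exists_optimal_flow
    (fun e => if e ∈ F then ((G.scc H (G.src e)).ncard : ℤ) else 0)
    (fun e => g₀ e + if e ∈ H then (κ * G.cap e : ℤ) else 0) g₀ hg₀
    (fun e => by
      have : (0 : ℤ) ≤ κ * G.cap e := by positivity
      split_ifs <;> linarith)
  have hle : ∀ e, g e ≤ g₀ e + κ * G.cap e := fun e => by
    refine (hub e).trans ?_
    have : (0 : ℤ) ≤ κ * G.cap e := by positivity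
    split_ifs <;> linarith
  refine ⟨g, hg, hgain, hle, fun e he => by simpa [he] using hub e, fun p _ hp => ?_⟩
  have hFC : ∀ z, ∀ e ∈ F, G.src e ∈ G.scc H z →
      G.tgt e ∈ G.scc H z ∧ (G.scc H (G.src e)).ncard = (G.scc H z).ncard := by
    intro z e he hs
    obtain ⟨C, hC, h1, h2⟩ := hFin e he
    have h3 := (G.isSCC_scc H z).eq_scc hs
    have h4 := hC.eq_scc h1
    exact ⟨by rw [h3, ← h4]; exact h2, by rw [← h3]⟩
  have hslack : ∀ e ∈ H,
      π (G.src e) + (if e ∈ F then ((G.scc H (G.src e)).ncard : ℤ) else 0) < π (G.tgt e) →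
      (κ : ℝ) * G.cap e ≤ g e := by
    intro e he hlt
    have h1 : ¬ g e < g₀ e + if e ∈ H then (κ * G.cap e : ℤ) else 0 :=
      fun h => absurd (hres e h) (not_le.2 hlt)
    rw [if_pos he] at h1
    have h2 := hg₀ e
    exact_mod_cast (by linarith : (κ * G.cap e : ℤ) ≤ g e)
  -- the bound for the component of `z`
  have hcomp : ∀ z, ∑ e, (if p e ∧ z ∈ G.scc H (G.src e) then (g e : ℝ) else 0) ≤
      P * (4 * B / φ + 2 * N) := by
    intro z
    refine G.component_bound (κ := κ) (π := π) (m := (G.scc H z).ncard) hφ hexp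
      (G.isSCC_scc H z) (fun e he hs => (hFC z e he hs).1) (by exact_mod_cast hκ) ?_ hB hP0 hg
      (fun e _ => le_trans (by exact_mod_cast hle e) (hup e)) ?_ ?_ ?_ ?_ ?_ ?_ _ ?_
    · have : 0 < (G.scc H z).ncard := (Set.ncard_pos (Set.toFinite _)).2 ⟨z, G.mem_scc_self H z⟩
      exact_mod_cast this
    · intro e he heF hlt
      exact hslack e he (by simpa [heF] using hlt)
    · intro e he heF hs hlt
      refine hslack e he ?_
      rw [if_pos heF, (hFC z e heF hs).2]
      exact hlt
    · intro e he
      refine le_trans ?_ (hrev e he)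
      split_ifs <;> simp
    · intro e heF hs he
      have := hrev e he
      rwa [if_pos heF, (hFC z e heF hs).2] at this
    · intro q W hq
      rw [hgain]
      exact hP q W hq
    · exact lt_of_le_of_lt (by exact_mod_cast G.vol_le_two_mul_sum F _) hN
    · exact fun e he => ⟨hp e he.1, G.mem_scc_comm.1 he.2⟩
  calc ∑ e, (if p e then ((G.scc H (G.src e)).ncard * g e : ℝ) else 0)
      = ∑ e, ∑ z, (if p e ∧ z ∈ G.scc H (G.src e) then (g e : ℝ) else 0) := by
        refine Finset.sum_congr rfl fun e _ => ?_
        by_cases h : p e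
        · simp only [h, true_and, if_true]
          rw [← Finset.sum_filter, Finset.sum_const, nsmul_eq_mul, Set.ncard_eq_toFinset_card']
          congr 3
          ext z
          simp
        · simp [h]
    _ = ∑ z, ∑ e, (if p e ∧ z ∈ G.scc H (G.src e) then (g e : ℝ) else 0) := Finset.sum_comm
    _ ≤ ∑ z : V, P * (4 * B / φ + 2 * N) := Finset.sum_le_sum fun z _ => hcomp z
    _ = _ := by rw [Finset.sum_const, nsmul_eq_mul, Finset.card_univ]

/-- Rerouting the top `d` levels, from the highest one down. Later steps only use edges of lower
levels and hence do not lengthen the part of the flow that has been dealt with. -/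
theorem exists_flow_short_above {φ : ℝ} (hφ : 0 < φ) {η : ℕ} {lev : E → Fin (η + 1)}
    (hH : G.IsExpanderHierarchy φ lev) {κ : ℕ} (hκ : 0 < κ) {f : E → ℤ} (hf : ∀ e, 0 ≤ f e)
    (hcong : ∀ e, f e ≤ κ * G.cap e) {P : ℝ} (hP0 : 0 ≤ P)
    (hP : ∀ (q : V → ℤ) (W : ℤ), (∀ x, 0 ≤ q x ∧ q x ≤ W) → (G.gain f q : ℝ) ≤ W * P) {N : ℕ}
    (hN : ((2 * ∑ e, G.cap e : ℕ) : ℝ) < (1 + φ / 2) ^ N) (d : ℕ) (hd : d ≤ η) :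
    ∃ g : E → ℤ, (∀ e, 0 ≤ g e) ∧ G.gain g = G.gain f ∧ (∀ e, g e ≤ (d + 1) * κ * G.cap e) ∧
      ∀ i : Fin (η + 1), η < i + d →
        ∑ e, (if lev e = i then ((G.scc (upToLevel lev i) (G.src e)).ncard * g e : ℝ) else 0) ≤
          Fintype.card V * (P * (4 * (η + 1) / φ + 2 * N)) := by
  induction d with
  | zero =>
    refine ⟨f, hf, rfl, by simpa using hcong, fun i hi => ?_⟩
    have := i.2
    omega
  | succ d ih =>
    obtain ⟨g₀, hg₀, hgain, hc, hshort⟩ := ih (by omega)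
    let j : Fin (η + 1) := ⟨η - d, by omega⟩
    have hj : j ≠ 0 := by
      intro h
      have := congrArg Fin.val h
      simp only [j, Fin.val_zero] at this
      omega
    have hjv : (j : ℕ) = η - d := rfl
    obtain ⟨g, hg, hgg, hle, hout, hb⟩ := G.exists_level_step hφ (hH.expanding j hj)
      (hH.contained j hj) hκ hg₀ (B := η + 1) (by positivity) hP0 (fun e => by
        have h1 : (g₀ e : ℝ) ≤ (d + 1) * κ * G.cap e := by exact_mod_cast hc e
        have h2 : ((d + 1 : ℕ) : ℝ) ≤ η := by exact_mod_cast hd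
        have h3 : ((d + 1 : ℕ) : ℝ) * (κ * G.cap e) ≤ η * (κ * G.cap e) := by gcongr
        push_cast at h3
        linarith) (by rw [hgain]; exact hP) hN
    refine ⟨g, hg, hgg.trans hgain, fun e => ?_, fun i hi => ?_⟩
    · have h1 := hc e
      have h2 := hle e
      push_cast
      linarith
    · rcases eq_or_ne i j with rfl | hij
      · exact hb (fun e => lev e = j) fun e he => he
      · have hlt : j < i := by
          rw [Fin.lt_def]
          have : (i : ℕ) ≠ j := fun h => hij (Fin.ext h)
          omega
        refine le_trans (Finset.sum_le_sum fun e _ => ?_) (hshort i (by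
          have : (j : ℕ) < i := hlt
          omega))
        split_ifs with he
        · have h3 : (g e : ℝ) ≤ g₀ e := by
            exact_mod_cast hout e fun h => absurd (he ▸ h : i ≤ j) (not_le.2 hlt)
          gcongr
        · exact le_rfl

/-- Since components occupy contiguous positions, an edge inside a component weighs at most as much
as the component is large. -/
theorem weight_le_ncard {η : ℕ} {φ : ℝ} {lev : E → Fin (η + 1)}
    {τ : V ≃ Fin (Fintype.card V)} (hH : G.IsExpanderHierarchy φ lev) (hτ : G.IsRespecting lev τ)
    {e : E} (he : lev e ≠ 0) :
    G.weight τ e ≤ (G.scc (upToLevel lev (lev e)) (G.src e)).ncard := by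
  obtain ⟨C, hC, h1, h2⟩ := hH.contained _ he e rfl
  have hco := hτ.contiguous _ he C hC
  rw [← hC.eq_scc h1]
  have hsub := hco.uIcc_subset (Set.mem_image_of_mem τ h1) (Set.mem_image_of_mem τ h2)
  have hcard := Set.ncard_le_ncard hsub (Set.toFinite _)
  rw [Set.ncard_image_of_injective _ τ.injective, ← Finset.coe_uIcc, Set.ncard_coe_finset,
    Fin.card_uIcc] at hcard
  have h3 : |((τ (G.tgt e) : ℕ) : ℤ) - ((τ (G.src e) : ℕ) : ℤ)| ≤ C.ncard := by
    rw [Int.abs_eq_natAbs]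
    exact_mod_cast (by omega :
      (((τ (G.tgt e) : ℕ) : ℤ) - ((τ (G.src e) : ℕ) : ℤ)).natAbs ≤ C.ncard)
  have h4 : ((|((τ (G.tgt e) : ℕ) : ℤ) - ((τ (G.src e) : ℕ) : ℤ)| : ℤ) : ℝ) ≤ C.ncard := by
    exact_mod_cast h3
  rw [weight]
  push_cast at h4
  exact h4

/-- The acyclic edges go forward in `τ`, so that their total weight is controlled by the net
displacement of the flow along `τ` and the weight of the other edges. -/
theorem exists_short_flow {φ : ℝ} (hφ : 0 < φ) {η : ℕ} {lev : E → Fin (η + 1)}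
    {τ : V ≃ Fin (Fintype.card V)} (hH : G.IsExpanderHierarchy φ lev) (hτ : G.IsRespecting lev τ)
    {κ : ℕ} (hκ : 0 < κ) {f : E → ℤ} (hf : ∀ e, 0 ≤ f e)
    (hcong : ∀ e, f e ≤ κ * G.cap e) {P : ℝ} (hP0 : 0 ≤ P)
    (hP : ∀ (q : V → ℤ) (W : ℤ), (∀ x, 0 ≤ q x ∧ q x ≤ W) → (G.gain f q : ℝ) ≤ W * P) {N : ℕ}
    (hN : ((2 * ∑ e, G.cap e : ℕ) : ℝ) < (1 + φ / 2) ^ N) :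
    ∃ g : E → ℤ, (∀ e, 0 ≤ g e) ∧ G.gain g = G.gain f ∧ (∀ e, g e ≤ (η + 1) * κ * G.cap e) ∧
      ∑ e, G.weight τ e * g e ≤
        Fintype.card V * P * (1 + 2 * η * (4 * (η + 1) / φ + 2 * N)) := by
  obtain ⟨g, hg, hgain, hc, hshort⟩ :=
    G.exists_flow_short_above hφ hH hκ hf hcong hP0 hP hN η le_rfl
  refine ⟨g, hg, hgain, hc, ?_⟩
  let q : V → ℤ := fun x => ((τ x : ℕ) : ℤ)
  have hq := hP q (Fintype.card V) fun x => ⟨by simp [q], by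
    have := (τ x).2
    simp only [q]
    omega⟩
  rw [← hgain] at hq
  have hw : ∀ e, 0 ≤ G.weight τ e * (g e : ℝ) := fun e =>
    mul_nonneg (abs_nonneg _) (by exact_mod_cast hg e)
  have hedge : ∀ e, G.weight τ e * (g e : ℝ) ≤ (g e * (q (G.tgt e) - q (G.src e)) : ℤ) +
      2 * (if lev e = 0 then 0 else G.weight τ e * g e) := by
    intro e
    have hge : (0 : ℝ) ≤ g e := by exact_mod_cast hg e
    have hdef : G.weight τ e = |((q (G.tgt e) : ℤ) : ℝ) - (q (G.src e) : ℤ)| := by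
      simp [weight, q]
    push_cast
    split_ifs with he
    · have h1 : (τ (G.src e) : ℕ) < (τ (G.tgt e) : ℕ) := hτ.topological e he
      have h2 : (0 : ℝ) ≤ ((q (G.tgt e) : ℤ) : ℝ) - (q (G.src e) : ℤ) := by
        simp only [q]
        rw [sub_nonneg]
        exact_mod_cast h1.le
      rw [hdef, abs_of_nonneg h2]
      linarith
    · have h2 := mul_le_mul_of_nonneg_right
        (neg_abs_le (((q (G.tgt e) : ℤ) : ℝ) - (q (G.src e) : ℤ))) hge
      rw [← hdef] at h2
      linarith
  have hX : ∑ e, (if lev e = 0 then 0 else G.weight τ e * (g e : ℝ)) ≤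
      η * (Fintype.card V * (P * (4 * (η + 1) / φ + 2 * N))) := by
    calc ∑ e, (if lev e = 0 then 0 else G.weight τ e * (g e : ℝ))
        = ∑ e, ∑ i : Fin η, (if lev e = i.succ then G.weight τ e * (g e : ℝ) else 0) := by
          refine Finset.sum_congr rfl fun e _ => ?_
          split_ifs with he
          · simp [he, (Fin.succ_ne_zero _).symm]
          · obtain ⟨k, hk⟩ := Fin.exists_succ_eq.2 he
            simp [← hk]
      _ = ∑ i : Fin η, ∑ e, (if lev e = i.succ then G.weight τ e * (g e : ℝ) else 0) :=
          Finset.sum_comm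
      _ ≤ ∑ i : Fin η, (Fintype.card V * (P * (4 * (η + 1) / φ + 2 * N)) : ℝ) := by
          refine Finset.sum_le_sum fun i _ => le_trans (Finset.sum_le_sum fun e _ => ?_)
            (hshort i.succ (by simp [Fin.val_succ]))
          split_ifs with he
          · have h1 := G.weight_le_ncard hH hτ (e := e) (he ▸ Fin.succ_ne_zero i)
            rw [he] at h1
            have hge : (0 : ℝ) ≤ g e := by exact_mod_cast hg e
            gcongr
          · exact le_rfl
      _ = _ := by simp
  have hsum := Finset.sum_le_sum fun e (_ : e ∈ Finset.univ) => hedge e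
  rw [Finset.sum_add_distrib, ← Finset.mul_sum, ← Int.cast_sum] at hsum
  change _ ≤ (G.gain g q : ℝ) + _ at hsum
  push_cast at hq
  calc _ ≤ Fintype.card V * P + 2 * (η * (Fintype.card V * (P * (4 * (η + 1) / φ + 2 * N)))) := by
        linarith
    _ = _ := by ring

/-! ### Flows and their values -/

theorem sum_mul_netOut (g : E → ℚ) (q : V → ℝ) :
    ∑ x, q x * G.netOut g x = -∑ e, (g e : ℝ) * (q (G.tgt e) - q (G.src e)) := by
  classical
  simp only [netOut, mul_sub, Finset.mul_sum, Finset.sum_sub_distrib, mul_ite, mul_zero]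
  rw [Finset.sum_comm, Finset.sum_comm (s := Finset.univ (α := V))]
  simp only [Finset.sum_ite_eq, Finset.mem_univ, if_true]
  rw [neg_sub]
  simp only [mul_comm]

theorem gain_cast (g : E → ℤ) (q : V → ℤ) :
    (G.gain g q : ℝ) = -∑ x, (q x : ℝ) * G.netOut (fun e => (g e : ℚ)) x := by
  rw [sum_mul_netOut, neg_neg, gain]
  push_cast
  rfl

theorem equivalent_of_gain_eq {g h : E → ℤ} (hgh : G.gain g = G.gain h) :
    G.Equivalent (fun e => (g e : ℚ)) (fun e => (h e : ℚ)) := by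
  classical
  intro x
  have h1 := G.gain_cast g (Pi.single x 1)
  have h2 := G.gain_cast h (Pi.single x 1)
  rw [hgh, h2, neg_inj] at h1
  simpa [Pi.single_apply] using h1.symm

variable {G}

theorem Equivalent.absorption_eq {V : Type u} {E : Type v} [Fintype E] {G : CapDigraph V E}
    {f g : E → ℚ} (h : G.Equivalent f g) (Δ T : V → ℝ) :
    G.absorption Δ T f = G.absorption Δ T g := by
  funext x
  rw [absorption, absorption, h x]

theorem Equivalent.value_eq {f g : E → ℚ} (h : G.Equivalent f g) (Δ T : V → ℝ) :
    G.value Δ T f = G.value Δ T g := by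
  rw [value, value, h.absorption_eq]

theorem Equivalent.isFlow {V : Type u} {E : Type v} [Fintype E] {G : CapDigraph V E}
    {f g : E → ℚ} (h : G.Equivalent f g) {Δ T : V → ℝ} (hf : G.IsFlow Δ T f) (hg : ∀ e, 0 ≤ g e) : G.IsFlow Δ T g := by
  refine ⟨hg, fun x => ?_⟩
  have := hf.2 x
  rwa [excess, h.absorption_eq, h x] at this

theorem IsFlow.value_nonneg {f : E → ℚ} {Δ T : V → ℝ} (hf : G.IsFlow Δ T f) :
    0 ≤ G.value Δ T f :=
  Finset.sum_nonneg fun x _ => (hf.2 x).1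

/-- A vertex that receives flow on balance absorbs it, so the value bounds the amount of flow. -/
theorem IsFlow.gain_le {g : E → ℤ} {Δ T : V → ℝ} (hf : G.IsFlow Δ T fun e => (g e : ℚ))
    {q : V → ℤ} {W : ℤ} (hq : ∀ x, 0 ≤ q x ∧ q x ≤ W) :
    (G.gain g q : ℝ) ≤ W * G.value Δ T fun e => (g e : ℚ) := by
  rw [gain_cast, value, Finset.mul_sum, ← Finset.sum_neg_distrib]
  refine Finset.sum_le_sum fun x _ => ?_
  obtain ⟨h1, -, h3⟩ := hf.2 x
  rw [excess] at h3
  have h4 : (0 : ℝ) ≤ q x := by exact_mod_cast (hq x).1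
  have h5 : (q x : ℝ) ≤ W := by exact_mod_cast (hq x).2
  calc -(q x * G.netOut (fun e => (g e : ℚ)) x)
      = q x * -G.netOut (fun e => (g e : ℚ)) x := by ring
    _ ≤ q x * G.absorption Δ T (fun e => (g e : ℚ)) x := by gcongr; linarith
    _ ≤ _ := by gcongr

/-- Scaling down a flow. Absorption is a concave function of the net outflow that is nonnegative
for the zero flow, so the value decreases at most by the same factor. -/
theorem IsFlow.smul {f : E → ℚ} {Δ T : V → ℝ} (hΔ : ∀ x, 0 ≤ Δ x) (hT : ∀ x, 0 ≤ T x)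
    (hf : G.IsFlow Δ T f) {s : ℚ} (h0 : 0 ≤ s) (h1 : s ≤ 1) :
    G.IsFlow Δ T (fun e => s * f e) ∧ s * G.value Δ T f ≤ G.value Δ T fun e => s * f e := by
  have hs0 : (0 : ℝ) ≤ s := by exact_mod_cast h0
  have hs1 : (s : ℝ) ≤ 1 := by exact_mod_cast h1
  have hnet : ∀ x, G.netOut (fun e => s * f e) x = s * G.netOut f x := by
    intro x
    simp only [netOut, mul_sub, Finset.mul_sum]
    push_cast
    simp only [mul_ite, mul_zero]
  have habs : ∀ x, s * G.absorption Δ T f x ≤ G.absorption Δ T (fun e => s * f e) x := by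
    intro x
    have h2 : G.absorption Δ T f x ≤ Δ x - G.netOut f x := min_le_left _ _
    have h3 : G.absorption Δ T f x ≤ T x := min_le_right _ _
    have h4 := mul_le_mul_of_nonneg_left h2 hs0
    have h5 := mul_le_mul_of_nonneg_left h3 hs0
    have h6 := mul_le_mul_of_nonneg_right hs1 (hΔ x)
    have h7 := mul_le_mul_of_nonneg_right hs1 (hT x)
    rw [absorption.eq_1 G Δ T (fun e => s * f e), hnet]
    exact le_min (by linarith) (by linarith)
  refine ⟨⟨fun e => mul_nonneg h0 (hf.1 e), fun x => ⟨?_, ?_, ?_⟩⟩, ?_⟩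
  · exact (mul_nonneg hs0 (hf.2 x).1).trans (habs x)
  · rw [excess]
    exact sub_nonneg.2 (min_le_left _ _)
  · have h3 := (hf.2 x).2.2
    have h4 : G.absorption Δ T f x ≤ T x := min_le_right _ _
    rw [excess] at h3
    have h5 : 0 ≤ T x + G.netOut f x := by linarith
    have h6 := mul_nonneg hs0 h5
    have h7 := mul_le_mul_of_nonneg_right hs1 (hT x)
    rw [excess, sub_le_iff_le_add, absorption, hnet, ← sub_le_iff_le_add']
    refine le_min ?_ ?_ <;> linarith [hΔ x]
  · rw [value, value, Finset.mul_sum]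
    exact Finset.sum_le_sum fun x _ => habs x

variable (G)

/-! ### The numerical bound -/

theorem lt_one_add_half_pow {φ : ℝ} (hφ : 0 < φ) (hφ1 : φ ≤ 1) {U : ℝ} (hU : 0 ≤ U) {N : ℕ}
    (hN : 4 / φ * Real.log (U + 1) ≤ N) : U < (1 + φ / 2) ^ N := by
  have h1 : φ / 4 ≤ Real.log (1 + φ / 2) := by
    refine le_trans ?_ (Real.one_sub_inv_le_log_of_pos (by positivity))
    rw [le_sub_iff_add_le, ← le_sub_iff_add_le', inv_le_iff_one_le_mul₀ (by positivity)]
    nlinarith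
  have h2 : Real.log (U + 1) ≤ N * Real.log (1 + φ / 2) := by
    have h3 := mul_le_mul_of_nonneg_left hN (show 0 ≤ φ / 4 by positivity)
    have h4 : φ / 4 * (4 / φ * Real.log (U + 1)) = Real.log (U + 1) := by field_simp
    have h5 := mul_le_mul_of_nonneg_left h1 (Nat.cast_nonneg (α := ℝ) N)
    linarith
  rw [← Real.log_pow, Real.log_le_log_iff (by positivity) (by positivity)] at h2
  linarith

/-- The number of growth steps needed for a volume of at most `2 * n ^ a`. -/
theorem exists_steps (a : ℕ) {n : ℕ} (hn : 2 ≤ n) {φ : ℝ} (hφ : 0 < φ) (hφ1 : φ ≤ 1) :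
    ∃ N : ℕ, (2 * (n : ℝ) ^ a) < (1 + φ / 2) ^ N ∧ (N : ℝ) ≤ (4 * a + 10) * Real.log n / φ := by
  have hn' : (2 : ℝ) ≤ n := by exact_mod_cast hn
  have hlog2 : 1 / 2 ≤ Real.log n := by
    have h1 := Real.log_le_log (by norm_num) hn'
    have h2 := Real.log_two_gt_d9
    linarith
  have hU : Real.log (2 * (n : ℝ) ^ a + 1) ≤ (a + 2) * Real.log n := by
    rw [show ((a : ℝ) + 2) * Real.log n = Real.log ((n : ℝ) ^ (a + 2)) by
      rw [Real.log_pow]; push_cast; ring]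
    refine Real.log_le_log (by positivity) ?_
    have h1 : (1 : ℝ) ≤ (n : ℝ) ^ a := one_le_pow₀ (by linarith)
    have h2 : (4 : ℝ) ≤ (n : ℝ) ^ 2 := by nlinarith
    rw [pow_add]
    nlinarith
  refine ⟨⌈4 / φ * Real.log (2 * (n : ℝ) ^ a + 1)⌉₊,
    lt_one_add_half_pow hφ hφ1 (by positivity) (Nat.le_ceil _), ?_⟩
  have h0 : 0 ≤ Real.log (2 * (n : ℝ) ^ a + 1) :=
    Real.log_nonneg (by have : (0 : ℝ) ≤ (n : ℝ) ^ a := by positivity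
                        linarith)
  refine (Nat.ceil_lt_add_one (by positivity)).le.trans ?_
  have h1 : 4 / φ * Real.log (2 * (n : ℝ) ^ a + 1) ≤ 4 / φ * ((a + 2) * Real.log n) := by gcongr
  have h2 : 1 ≤ 2 * Real.log n / φ := by
    rw [le_div_iff₀ hφ]
    linarith
  calc _ ≤ 4 / φ * ((a + 2) * Real.log n) + 2 * Real.log n / φ := by linarith
    _ = _ := by ring

/-- The routing of an integral flow along edges of small weight, with the constant
`16 * a + 90`. -/
theorem exists_equivalent_short_flow (a : ℕ) {φ : ℝ} {η : ℕ} {lev : E → Fin (η + 1)}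
    {τ : V ≃ Fin (Fintype.card V)} {Δ T : V → ℝ} (hcap : ∑ e, G.cap e ≤ Fintype.card V ^ a)
    (hφ : 0 < φ) (hφ1 : φ ≤ 1) (hη : 1 ≤ η) (hH : G.IsExpanderHierarchy φ lev)
    (hτ : G.IsRespecting lev τ) (κ : ℕ) {f : E → ℚ} (hf : G.IsFlow Δ T f)
    (hint : IsIntegral f) (hcong : G.CongestionLE f κ) :
    ∃ f' : E → ℚ, G.IsFlow Δ T f' ∧ G.Equivalent f f' ∧
      G.CongestionLE f' (((η : ℚ) + 1) * κ) ∧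
      G.flowWeight τ f' ≤ G.value Δ T f' * ((16 * a + 90) *
        ((Fintype.card V : ℝ) * ((η : ℝ) ^ 2 * Real.log (Fintype.card V) / φ))) := by
  have hbound : 0 ≤ G.value Δ T f * ((16 * a + 90) *
      ((Fintype.card V : ℝ) * ((η : ℝ) ^ 2 * Real.log (Fintype.card V) / φ))) := by
    have := hf.value_nonneg
    have := Real.log_natCast_nonneg (Fintype.card V)
    positivity
  have hfκ : ∀ {b : ℕ}, 1 ≤ b → G.CongestionLE f ((b : ℚ) * κ) := fun {b} hb e => by
    refine (hcong e).trans ?_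
    have h1 : (1 : ℚ) ≤ b := by exact_mod_cast hb
    have h2 : (0 : ℚ) ≤ (κ : ℚ) * G.cap e := by positivity
    nlinarith
  have hfη : G.CongestionLE f (((η : ℚ) + 1) * κ) := by
    have := hfκ (b := η + 1) (by omega)
    push_cast at this
    exact this
  -- In the degenerate cases the flow itself has weight `0`.
  by_cases hdeg : κ = 0 ∨ Fintype.card V ≤ 1
  · refine ⟨f, hf, fun _ => rfl, hfη, ?_⟩
    have : G.flowWeight τ f = 0 := by
      refine Finset.sum_eq_zero fun e _ => ?_
      rcases hdeg with rfl | hV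
      · have h1 := hcong e
        have h2 := hf.1 e
        have : f e = 0 := by
          simp only [Nat.cast_zero, zero_mul] at h1
          exact le_antisymm h1 h2
        simp [this]
      · have := Fintype.card_le_one_iff_subsingleton.1 hV
        have : G.tgt e = G.src e := Subsingleton.elim _ _
        simp [weight, this]
    rw [this]
    exact hbound
  · rw [not_or] at hdeg
    have hκ : 0 < κ := Nat.pos_of_ne_zero hdeg.1
    have hn : 2 ≤ Fintype.card V := by omega
    obtain ⟨N, hN, hNle⟩ := exists_steps a hn hφ hφ1
    choose k hk using hint
    obtain rfl : f = fun e => (((k e : ℕ) : ℤ) : ℚ) := by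
      funext e
      rw [hk e]
      simp
    have hU : ((2 * ∑ e, G.cap e : ℕ) : ℝ) < (1 + φ / 2) ^ N := by
      refine lt_of_le_of_lt ?_ hN
      have : ((∑ e, G.cap e : ℕ) : ℝ) ≤ (Fintype.card V : ℝ) ^ a := by exact_mod_cast hcap
      push_cast at this ⊢
      linarith
    obtain ⟨g, hg, hgain, hc, hw⟩ := G.exists_short_flow hφ hH hτ hκ
      (f := fun e => ((k e : ℕ) : ℤ)) (fun e => Int.natCast_nonneg _)
      (fun e => by
        have : (((k e : ℕ) : ℤ) : ℚ) ≤ κ * G.cap e := hcong e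
        exact_mod_cast this) hf.value_nonneg (fun q W hq => hf.gain_le hq) hU
    have heq : G.Equivalent (fun e => (((k e : ℕ) : ℤ) : ℚ)) (fun e => (g e : ℚ)) :=
      G.equivalent_of_gain_eq hgain.symm
    refine ⟨fun e => (g e : ℚ), heq.isFlow hf fun e => by exact_mod_cast hg e, heq,
      fun e => ?_, ?_⟩
    · change (g e : ℚ) ≤ _
      exact_mod_cast hc e
    rw [← heq.value_eq]
    have hP0 := hf.value_nonneg
    generalize G.value Δ T _ = P at hP0 hw ⊢
    have hη' : (1 : ℝ) ≤ η := by exact_mod_cast hη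
    have hlog : 1 / 2 ≤ Real.log (Fintype.card V) := by
      have h1 := Real.log_le_log (by norm_num) (show (2 : ℝ) ≤ Fintype.card V by exact_mod_cast hn)
      have h2 := Real.log_two_gt_d9
      linarith
    -- Everything is measured in units of `η ^ 2 * log n / φ`.
    have h1 : 1 ≤ 2 * ((η : ℝ) ^ 2 * Real.log (Fintype.card V) / φ) := by
      rw [mul_div_assoc', le_div_iff₀ hφ]
      nlinarith
    have h2 : 2 * η * (4 * (η + 1) / φ) ≤
        32 * ((η : ℝ) ^ 2 * Real.log (Fintype.card V) / φ) := by
      rw [mul_div_assoc', mul_div_assoc', div_le_div_iff_of_pos_right hφ]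
      nlinarith
    have h3 : 2 * η * (2 * (N : ℝ)) ≤
        (16 * a + 40) * ((η : ℝ) ^ 2 * Real.log (Fintype.card V) / φ) := by
      calc 2 * η * (2 * (N : ℝ))
          ≤ 2 * η * (2 * ((4 * a + 10) * Real.log (Fintype.card V) / φ)) := by gcongr
        _ = (16 * a + 40) * (η * Real.log (Fintype.card V) / φ) := by ring
        _ ≤ _ := by gcongr; nlinarith
    have h4 : 1 + 2 * η * (4 * (η + 1) / φ + 2 * N) ≤
        (16 * a + 90) * ((η : ℝ) ^ 2 * Real.log (Fintype.card V) / φ) := by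
      have h5 : 0 ≤ (η : ℝ) ^ 2 * Real.log (Fintype.card V) / φ := by positivity
      linarith
    calc G.flowWeight τ (fun e => (g e : ℚ)) = ∑ e, G.weight τ e * g e := by simp [flowWeight]
      _ ≤ _ := hw
      _ ≤ Fintype.card V * P *
          ((16 * a + 90) * ((η : ℝ) ^ 2 * Real.log (Fintype.card V) / φ)) := by gcongr
      _ = _ := by ring

end CapDigraph
end

theorem mainTheorem4 (a : ℕ) :
    ∃ K : ℝ, 0 < K ∧
      ∀ (V : Type u) (E : Type v) [Fintype V] [Fintype E] (G : CapDigraph V E)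
        (φ : ℝ) (η : ℕ) (lev : E → Fin (η + 1)) (τ : V ≃ Fin (Fintype.card V))
        (Δ T : V → ℝ),
        ∑ e, G.cap e ≤ Fintype.card V ^ a →
        0 < φ → φ ≤ 1 → 1 ≤ η →
        G.IsExpanderHierarchy φ lev → G.IsRespecting lev τ →
        (∀ x, 0 ≤ Δ x) → (∀ x, 0 ≤ T x) →
        (∀ f : E → ℚ, G.IsFlow Δ T f → CapDigraph.IsIntegral f → G.IsFeasible f →
          ∃ f' : E → ℚ, G.IsFlow Δ T f' ∧ G.IsFeasible f' ∧
            G.value Δ T f / ((η : ℝ) + 1) ≤ G.value Δ T f' ∧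
            G.flowWeight τ f' ≤ G.value Δ T f' *
              (K * ((Fintype.card V : ℝ) * ((η : ℝ) ^ 2 * Real.log (Fintype.card V) / φ)))) ∧
        (∀ (κ : ℕ) (f : E → ℚ), G.IsFlow Δ T f → CapDigraph.IsIntegral f →
          G.CongestionLE f κ →
          ∃ f' : E → ℚ, G.IsFlow Δ T f' ∧ G.Equivalent f f' ∧
            G.CongestionLE f' (((η : ℚ) + 1) * κ) ∧
            G.flowWeight τ f' ≤ G.value Δ T f' *
              (K * ((Fintype.card V : ℝ) * ((η : ℝ) ^ 2 * Real.log (Fintype.card V) / φ)))) := by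
  refine ⟨16 * a + 90, by positivity, ?_⟩
  intro V E _ _ G φ η lev τ Δ T hcap hφ hφ1 hη hH hτ hΔ hT
  refine ⟨fun f hf hint hfeas => ?_, fun κ f hf hint hcong =>
    G.exists_equivalent_short_flow a hcap hφ hφ1 hη hH hτ κ hf hint hcong⟩
  obtain ⟨g, hg, heq, hc, hw⟩ := G.exists_equivalent_short_flow a hcap hφ hφ1 hη hH hτ 1 hf hint
    (fun e => by simpa using hfeas e)
  have hη0 : (0 : ℚ) < (η : ℚ) + 1 := by positivity
  obtain ⟨h1, h2⟩ := hg.smul hΔ hT (s := ((η : ℚ) + 1)⁻¹) (by positivity)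
    (inv_le_one_of_one_le₀ (by linarith [Nat.cast_nonneg (α := ℚ) η]))
  refine ⟨_, h1, fun e => ?_, ?_, ?_⟩
  · have h3 := hc e
    rw [inv_mul_le_iff₀ hη0]
    simpa using h3
  · rw [heq.value_eq, div_eq_inv_mul]
    push_cast at h2
    exact h2
  · have h3 : G.flowWeight τ (fun e => ((η : ℚ) + 1)⁻¹ * g e) =
        ((((η : ℚ) + 1)⁻¹ : ℚ) : ℝ) * G.flowWeight τ g := by
      simp only [CapDigraph.flowWeight, Finset.mul_sum]
      refine Finset.sum_congr rfl fun e _ => ?_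
      push_cast
      ring
    rw [h3]
    have hs : (0 : ℝ) ≤ ((((η : ℚ) + 1)⁻¹ : ℚ) : ℝ) := by
      push_cast
      positivity
    refine (mul_le_mul_of_nonneg_left hw hs).trans ?_
    rw [← mul_assoc]
    refine mul_le_mul_of_nonneg_right h2 ?_
    have := Real.log_natCast_nonneg (Fintype.card V)
    positivity
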